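/- Let $1\le d\le n$ be integers. Let $T_{n,d}=(S^{d-1})^n$ be the product of $n$ copies of the unit sphere $S^{d-1}\subset\mathbb{R}^d$, with its product smooth structure; a point of $T_{n,d}$ is regarded as a matrix $Y\in\mathbb{R}^{n\times d}$ all of whose rows have Euclidean norm $1$. Put $$T^*_{n,d}=\{\,Y\in T_{n,d} : \operatorname{rank}(Y)=d\,\},$$ and let the group $O_d$ of orthogonal $d\times d$ matrices act on $T^*_{n,d}$ from the right by $(Y,Q)\mapsto YQ$. Then: 1. $T^*_{n,d}$ is an open subset of the smooth manifold $T_{n,d}$; with the induced charts it is a smooth manifold, and its inclusion into $T_{n,d}$ is a smooth embedding. 2. The action of $O_d$ on $T^*_{n,d}$ is free (if $YQ=Y$ for some $Y\in T^*_{n,d}$, then $Q=I_d$) and proper (the map $(Y,Q)\mapsto(YQ,Y)$ from $T^*_{n,d}\times O_d$ to $T^*_{n,d}\times T^*_{n,d}$ is proper). The orbit space $M^*_{n,d}=T^*_{n,d}/O_d$ with the quotient topology is Hausdorff and second countable, and it carries the structure of a smooth manifold of dimension $$n(d-1)-\frac{d(d-1)}{2}$$ for which the canonical projection $\pi:T^*_{n,d}\to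 M^*_{n,d}$ is a smooth submersion. -/

import Mathlib

open scoped Manifold ContDiff

noncomputable section

namespace CorrelationManifold

/-- For `d ≥ 1` the space `ℝ^d` has dimension `(d - 1) + 1`. Mathlib uses this fact to equip the unit
sphere of `ℝ^d` with its standard structure of a manifold of dimension `d - 1`. -/
instance factFinrank (d : ℕ) [NeZero d] :
    Fact (Module.finrank ℝ (EuclideanSpace ℝ (Fin d)) = (d - 1) + 1) :=
  ⟨by rw [finrank_euclideanSpace_fin, Nat.sub_add_cancel (NeZero.one_le)]⟩

/-- The unit sphere `S^{d-1}` in Euclidean space `ℝ^d`. -/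
abbrev UnitSphere (d : ℕ) : Type := Metric.sphere (0 : EuclideanSpace ℝ (Fin d)) 1

/-- `T_{n,d}`: the product of `n` copies of `S^{d-1}`, with the product topology and the product
charts (Mathlib's `piChartedSpace`). -/
abbrev T (n d : ℕ) : Type := Fin n → UnitSphere d

/-- The space on which the product of spheres is modelled: `n` copies of `ℝ^{d-1}`. -/
abbrev TModel (n d : ℕ) : Type := ModelPi fun _ : Fin n => EuclideanSpace ℝ (Fin (d - 1))

/-- The (boundaryless) model with corners of the product of spheres. -/
abbrev TModelWithCorners (n d : ℕ) :
    ModelWithCorners ℝ (Fin n → EuclideanSpace ℝ (Fin (d - 1))) (TModel n d) :=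
  ModelWithCorners.pi fun _ : Fin n => 𝓡 (d - 1)

/-- A point of `T_{n,d}` as an `n × d` matrix, whose rows are the given unit vectors. -/
def toMatrix {n d : ℕ} (Y : T n d) : Matrix (Fin n) (Fin d) ℝ :=
  Matrix.of fun i j => (Y i : EuclideanSpace ℝ (Fin d)) j

/-- The orthogonal group `O_d` of orthogonal `d × d` matrices. -/
abbrev O (d : ℕ) := Matrix.orthogonalGroup (Fin d) ℝ

theorem norm_vecMul {d : ℕ} (Q : O d) (v : UnitSphere d) :
    WithLp.toLp 2 (Matrix.vecMul (v : EuclideanSpace ℝ (Fin d)).ofLp (Q : Matrix (Fin d) (Fin d) ℝ))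
      ∈ Metric.sphere (0 : EuclideanSpace ℝ (Fin d)) 1 := by
  have hQ : (Q : Matrix (Fin d) (Fin d) ℝ) * (Q : Matrix (Fin d) (Fin d) ℝ).transpose = 1 :=
    Matrix.mem_orthogonalGroup_iff (Fin d) ℝ |>.1 Q.2
  have hv : ‖(v : EuclideanSpace ℝ (Fin d))‖ ^ 2 = 1 := by
    rw [norm_eq_of_mem_sphere v]; norm_num
  rw [mem_sphere_zero_iff_norm, ← sq_eq_sq₀ (norm_nonneg _) zero_le_one, one_pow]
  rw [EuclideanSpace.real_norm_sq_eq] at hv ⊢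
  have key : ∀ w : Fin d → ℝ, ∑ i, w i ^ 2 = w ⬝ᵥ w := fun w => by
    simp [dotProduct, sq]
  rw [key] at hv ⊢
  rw [← Matrix.dotProduct_mulVec, ← Matrix.vecMul_transpose, Matrix.vecMul_vecMul, hQ,
    Matrix.vecMul_one]
  exact hv

/-- The right translate `Y Q` of `Y ∈ T_{n,d}` by `Q ∈ O_d`: every row is multiplied by `Q` from the
right. -/
def rightMul {n d : ℕ} (Y : T n d) (Q : O d) : T n d := fun i =>
  ⟨WithLp.toLp 2 (Matrix.vecMul (Y i : EuclideanSpace ℝ (Fin d)).ofLp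
    (Q : Matrix (Fin d) (Fin d) ℝ)), norm_vecMul Q (Y i)⟩

theorem toMatrix_injective {n d : ℕ} : Function.Injective (toMatrix (n := n) (d := d)) := by
  intro Y Z h
  funext i
  apply Subtype.ext
  ext j
  exact congrFun (congrFun h i) j

theorem toMatrix_rightMul {n d : ℕ} (Y : T n d) (Q : O d) :
    toMatrix (rightMul Y Q) = toMatrix Y * (Q : Matrix (Fin d) (Fin d) ℝ) := by
  ext i j
  rfl

/-- `T*_{n,d}`: the points of `T_{n,d}` of rank exactly `d`. -/
def TStar (n d : ℕ) : Set (T n d) := {Y | (toMatrix Y).rank = d}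

theorem rightMul_mem_TStar {n d : ℕ} {Y : T n d} (hY : Y ∈ TStar n d) (Q : O d) :
    rightMul Y Q ∈ TStar n d := by
  change (toMatrix (rightMul Y Q)).rank = d
  rw [toMatrix_rightMul, Matrix.rank_mul_eq_left_of_isUnit_det]
  · exact hY
  · have h := (Matrix.mem_orthogonalGroup_iff (Fin d) ℝ).1 Q.2
    exact Matrix.isUnit_det_of_right_inverse h

/-- The right action `(Y, Q) ↦ Y Q` of `O_d` on `T*_{n,d}`, in Mathlib's encoding of right actions
as actions of the opposite group. -/
instance actionTStar (n d : ℕ) : MulAction (O d)ᵐᵒᵖ (TStar n d) where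
  smul Q Y := ⟨rightMul Y.1 Q.unop, rightMul_mem_TStar Y.2 Q.unop⟩
  one_smul Y := Subtype.ext <| toMatrix_injective <| by
    change toMatrix (rightMul Y.1 1) = _
    simp [toMatrix_rightMul]
  mul_smul P Q Y := Subtype.ext <| toMatrix_injective <| by
    change toMatrix (rightMul Y.1 (Q.unop * P.unop)) =
      toMatrix (rightMul (rightMul Y.1 Q.unop) P.unop)
    simp [toMatrix_rightMul, Matrix.mul_assoc]

/-- `M*_{n,d} = T*_{n,d} / O_d`: the orbit space, with the quotient topology. -/
abbrev MStar (n d : ℕ) : Type := MulAction.orbitRel.Quotient (O d)ᵐᵒᵖ (TStar n d)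

/-- The canonical projection `π : T*_{n,d} → M*_{n,d}`. -/
def proj (n d : ℕ) : TStar n d → MStar n d := Quotient.mk _

/-- The charts which the open set `T*_{n,d}` inherits from the product of spheres `T_{n,d}`
(restrictions of the charts of `T_{n,d}`), once it is known to be open. -/
abbrev chartedSpaceTStar {n d : ℕ} [NeZero d] (h : IsOpen (TStar n d)) :
    ChartedSpace (TModel n d) (TStar n d) :=
  inferInstanceAs (ChartedSpace (TModel n d) (⟨TStar n d, h⟩ : TopologicalSpace.Opens (T n d)))

end CorrelationManifold

end

/-! The action is proper because `O d` is compact. Rank `d` means that some `d` rows are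
independent, which is an open condition; these rows form an invertible block, which can be
cancelled, so the action is free. The quotient is Hausdorff by properness and second countable
because `proj` is open.

Charts of the quotient come from Gram-Schmidt. Near a given point fix `d` independent rows `e`;
orthogonalizing them gives `frame e Y`, and the coordinates `rowCoord e Y` of all rows in this frame
are a complete set of `O d`-invariants. Invariance (`rowCoord_rightMul`) follows from uniqueness:
the frame is the only orthonormal basis in which the selected rows are triangular with positive
diagonal. The unit-norm condition is removed by choosing in each row a nonzero pivot coordinate,
fixing its sign and rescaling the row to a prescribed pivot. The remaining entries, apart from the
forced zeros, are then arbitrary reals (`sliceCoord`), and normalizing the rows inverts this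
(`slicePoint`). Each such pair is a `SmoothSlice`; `SmoothSlice.exists_isManifold` turns a family of
slices into an atlas. -/

open scoped Manifold ContDiff Topology
open Set

/-! ### Finite products and open subsets of manifolds. -/

section PiManifold

variable {𝕜 : Type*} [NontriviallyNormedField 𝕜] {ι : Type*} [Fintype ι]
  {E : ι → Type*} [∀ i, NormedAddCommGroup (E i)] [∀ i, NormedSpace 𝕜 (E i)]
  {H : ι → Type*} [∀ i, TopologicalSpace (H i)] (I : ∀ i, ModelWithCorners 𝕜 (E i) (H i))
  {M : ι → Type*} [∀ i, TopologicalSpace (M i)] [∀ i, ChartedSpace (H i) (M i)]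
  {E' : Type*} [NormedAddCommGroup E'] [NormedSpace 𝕜 E'] {H' : Type*} [TopologicalSpace H']
  {J : ModelWithCorners 𝕜 E' H'} {N : Type*} [TopologicalSpace N] [ChartedSpace H' N]
  {n : WithTop ℕ∞}

/-- A finite product of `C^n` manifolds is a `C^n` manifold. -/
theorem IsManifold.pi [∀ i, IsManifold (I i) n (M i)] :
    IsManifold (ModelWithCorners.pi I) n (∀ i, M i) := by
  apply isManifold_of_contDiffOn
  rintro _ _ ⟨e, he, rfl⟩ ⟨e', he', rfl⟩
  rw [contDiffOn_pi]
  intro i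
  have h := (contDiffGroupoid n (I i)).compatible (he i trivial) (he' i trivial)
  rw [contDiffGroupoid, mem_groupoid_of_pregroupoid] at h
  refine h.1.comp (ContinuousLinearMap.proj (R := 𝕜) (φ := E) i).contDiff.contDiffOn ?_
  rintro x ⟨hx, y, rfl⟩
  refine ⟨⟨hx.1 i trivial, hx.2 i trivial⟩, y i, rfl⟩

/-- Charts of the product are products of charts, so the chart expression of `f` is by definition
the tuple of those of its components. -/
theorem contMDiffAt_pi_iff {f : N → ∀ i, M i} {x : N} :
    ContMDiffAt J (ModelWithCorners.pi I) n f x ↔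
      ∀ i, ContMDiffAt J (I i) n (fun y => f y i) x := by
  simp only [contMDiffAt_iff, continuousAt_pi, forall_and]
  refine and_congr Iff.rfl ?_
  rw [← contDiffWithinAt_pi]
  rfl

theorem contMDiff_pi_iff {f : N → ∀ i, M i} :
    ContMDiff J (ModelWithCorners.pi I) n f ↔ ∀ i, ContMDiff J (I i) n (fun y => f y i) :=
  ⟨fun h i x => (contMDiffAt_pi_iff I).1 (h x) i,
    fun h x => (contMDiffAt_pi_iff I).2 fun i => h i x⟩

theorem contMDiff_pi_apply (i : ι) [∀ i, IsManifold (I i) n (M i)] :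
    ContMDiff (ModelWithCorners.pi I) (I i) n (fun f : ∀ i, M i => f i) :=
  (contMDiff_pi_iff I).1 contMDiff_id i

end PiManifold

section Opens
variable {𝕜 : Type*} [NontriviallyNormedField 𝕜]
  {E : Type*} [NormedAddCommGroup E] [NormedSpace 𝕜 E]
  {H : Type*} [TopologicalSpace H] {I : ModelWithCorners 𝕜 E H}
  {M : Type*} [TopologicalSpace M] [ChartedSpace H M]
  {E' : Type*} [NormedAddCommGroup E'] [NormedSpace 𝕜 E'] {H' : Type*} [TopologicalSpace H']
  {J : ModelWithCorners 𝕜 E' H'} {N : Type*} [TopologicalSpace N] [ChartedSpace H' N]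
  {n : WithTop ℕ∞}

/-- A map into an open subset of a manifold is `C^n` if it is `C^n` as a map into the manifold. -/
theorem ContMDiff.of_coe_opens {U : TopologicalSpace.Opens M} {f : N → U}
    (hf : ContMDiff J I n (fun x => (f x : M))) : ContMDiff J I n f := by
  intro x
  have h := hf x
  rw [contMDiffAt_iff] at h ⊢
  exact ⟨Topology.IsInducing.subtypeVal.continuousAt_iff.2 h.1, h.2⟩

end Opens

/-! ### Smooth structure on the base of a projection with slices. -/

section QuotientManifold

variable {E : Type*} [NormedAddCommGroup E] [NormedSpace ℝ E]
  {H : Type*} [TopologicalSpace H] (I : ModelWithCorners ℝ E H)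
  {X : Type*} [TopologicalSpace X] [ChartedSpace H X]
  {F : Type*} (F) [NormedAddCommGroup F] [NormedSpace ℝ F]
  {M : Type*} [TopologicalSpace M] (π : X → M)

/-- A smooth local trivialization of a projection `π : X → M`: a smooth function `coord` on a
saturated open set, constant on the fibres of `π`, with values in the vector space `F`, and a smooth
map `sect` from `F` that is inverse to `coord` up to `π`. -/
structure SmoothSlice where
  source : Set X
  coord : X → F
  sect : F → X
  isOpen_source : IsOpen source
  contMDiffOn_coord : ContMDiffOn I 𝓘(ℝ, F) ∞ coord source
  contMDiff_sect : ContMDiff 𝓘(ℝ, F) I ∞ sect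
  sect_mem : ∀ w, sect w ∈ source
  coord_sect : ∀ w, coord (sect w) = w
  proj_sect_coord : ∀ x ∈ source, π (sect (coord x)) = π x
  saturated : ∀ x ∈ source, ∀ y, π y = π x → y ∈ source ∧ coord y = coord x

namespace SmoothSlice

variable {I F π}

/-- The chart of the base of a projection given by a smooth slice. -/
noncomputable def chart (S : SmoothSlice I F π) (hπ : IsOpenQuotientMap π) :
    OpenPartialHomeomorph M F where
  -- The representative is arbitrary: on the saturated source, `coord` depends only on the fibre.
  toFun m := S.coord (Function.surjInv hπ.surjective m)
  invFun w := π (S.sect w)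
  source := π '' S.source
  target := univ
  map_source' _ _ := trivial
  map_target' w _ := ⟨_, S.sect_mem w, rfl⟩
  left_inv' := by
    rintro _ ⟨x, hx, rfl⟩
    have h := S.saturated x hx _ (Function.surjInv_eq hπ.surjective (π x))
    rw [h.2, S.proj_sect_coord x hx]
  right_inv' w _ := by
    have h := S.saturated _ (S.sect_mem w) _ (Function.surjInv_eq hπ.surjective (π (S.sect w)))
    rw [h.2, S.coord_sect]
  open_source := hπ.isOpenMap _ S.isOpen_source
  open_target := isOpen_univ
  continuousOn_toFun := by
    rintro _ ⟨x, hx, rfl⟩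
    refine ContinuousAt.continuousWithinAt ?_
    -- As `π` is open, neighbourhoods of `π x` are images of those of `x`, so continuity is checked
    -- upstairs.
    rw [ContinuousAt, ← hπ.isOpenMap.map_nhds_eq hπ.continuous.continuousAt,
      Filter.tendsto_map'_iff]
    have key : ∀ y ∈ S.source, S.coord (Function.surjInv hπ.surjective (π y)) = S.coord y :=
      fun y hy => (S.saturated y hy _ (Function.surjInv_eq hπ.surjective (π y))).2
    have hU := S.isOpen_source.mem_nhds hx
    rw [key x hx]
    refine Filter.Tendsto.congr' ?_ (S.contMDiffOn_coord.continuousOn.continuousAt hU)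
    filter_upwards [hU] with y hy using (key y hy).symm
  continuousOn_invFun := (hπ.continuous.comp S.contMDiff_sect.continuous).continuousOn

theorem chart_proj (S : SmoothSlice I F π) (hπ : IsOpenQuotientMap π) {x : X} (hx : x ∈ S.source) :
    S.chart hπ (π x) = S.coord x :=
  (S.saturated x hx _ (Function.surjInv_eq hπ.surjective (π x))).2

theorem mem_source_of_proj_mem (S : SmoothSlice I F π) (hπ : IsOpenQuotientMap π) {x : X}
    (hx : π x ∈ (S.chart hπ).source) : x ∈ S.source := by
  obtain ⟨y, hy, hxy⟩ := hx
  exact (S.saturated y hy x hxy.symm).1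

/-- The charted space structure on the base of a projection which has smooth slices. -/
@[reducible]
noncomputable def chartedSpace (S : X → SmoothSlice I F π) (hS : ∀ x, x ∈ (S x).source)
    (hπ : IsOpenQuotientMap π) : ChartedSpace F M where
  atlas := range fun x => (S x).chart hπ
  chartAt m := (S (Function.surjInv hπ.surjective m)).chart hπ
  mem_chart_source m := ⟨_, hS _, Function.surjInv_eq hπ.surjective m⟩
  chart_mem_atlas _ := ⟨_, rfl⟩

/-- A projection with enough smooth slices makes its base a smooth manifold, and is then a smooth
submersion. -/
theorem exists_isManifold (S : X → SmoothSlice I F π) (hS : ∀ x, x ∈ (S x).source)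
    (hsect : ∀ x, (S x).sect ((S x).coord x) = x) (hπ : IsOpenQuotientMap π) :
    ∃ _ : ChartedSpace F M, IsManifold 𝓘(ℝ, F) ∞ M ∧ ContMDiff I 𝓘(ℝ, F) ∞ π ∧
      ∀ x, Function.Surjective (mfderiv I 𝓘(ℝ, F) π x) := by
  let := chartedSpace S hS hπ
  have hman : IsManifold 𝓘(ℝ, F) ∞ M := by
    apply isManifold_of_contDiffOn
    rintro _ _ ⟨x, rfl⟩ ⟨y, rfl⟩
    rw [← contMDiffOn_iff_contDiffOn]
    have hmem : ∀ w ∈ 𝓘(ℝ, F).symm ⁻¹' (((S x).chart hπ).symm ≫ₕ (S y).chart hπ).source ∩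
        range 𝓘(ℝ, F), (S x).sect w ∈ (S y).source := fun w hw =>
      (S y).mem_source_of_proj_mem hπ hw.1.2
    -- The transition map is `coord` of one slice after `sect` of the other.
    refine ((S y).contMDiffOn_coord.comp (S x).contMDiff_sect.contMDiffOn hmem).congr ?_
    intro w hw
    exact (S y).chart_proj hπ (hmem w hw)
  have hmem : ∀ x, (S x).chart hπ ∈ IsManifold.maximalAtlas 𝓘(ℝ, F) ∞ M := fun x =>
    IsManifold.subset_maximalAtlas ⟨x, rfl⟩
  have hsmooth : ContMDiff I 𝓘(ℝ, F) ∞ π := by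
    intro x
    have h1 : ContMDiffAt I 𝓘(ℝ, F) ∞ (S x).coord x :=
      (S x).contMDiffOn_coord.contMDiffAt ((S x).isOpen_source.mem_nhds (hS x))
    have h2 : ContMDiffAt 𝓘(ℝ, F) 𝓘(ℝ, F) ∞ ((S x).chart hπ).symm ((S x).coord x) :=
      contMDiffAt_symm_of_mem_maximalAtlas (hmem x) trivial
    refine (h2.comp x h1).congr_of_eventuallyEq ?_
    filter_upwards [(S x).isOpen_source.mem_nhds (hS x)] with y hy
    exact ((S x).proj_sect_coord y hy).symm
  refine ⟨inferInstance, hman, hsmooth, fun x => ?_⟩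
  have hd : ((S x).chart hπ).MDifferentiable 𝓘(ℝ, F) 𝓘(ℝ, F) :=
    ⟨(contMDiffOn_of_mem_maximalAtlas (hmem x)).mdifferentiableOn (by simp),
      (contMDiffOn_symm_of_mem_maximalAtlas (hmem x)).mdifferentiableOn (by simp)⟩
  have hsurj := hd.symm.mfderiv_surjective (x := (S x).coord x) trivial
  -- The inverse chart has surjective derivative and factors through `π`; since `sect` passes
  -- through `x` itself, the derivative of `π` at `x` is surjective.
  have hcomp : (((S x).chart hπ).symm : F → M) = π ∘ (S x).sect := rfl
  rw [hcomp, mfderiv_comp _ ((hsmooth _).mdifferentiableAt (by simp))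
    (((S x).contMDiff_sect _).mdifferentiableAt (by simp))] at hsurj
  rw [hsect] at hsurj
  exact fun v => let ⟨u, hu⟩ := hsurj v; ⟨_, hu⟩

end SmoothSlice

end QuotientManifold

/-! ### Smoothness and uniqueness of Gram-Schmidt orthogonalization. -/

section GramSchmidt

open InnerProductSpace

variable {V : Type*} [NormedAddCommGroup V] [InnerProductSpace ℝ V]
  {ι : Type*} [LinearOrder ι] [LocallyFiniteOrderBot ι] [WellFoundedLT ι]

theorem inner_gramSchmidtNormed_of_lt (v : ι → V) {k j : ι} (hkj : k < j) :
    inner ℝ (gramSchmidtNormed ℝ v j) (v k) = 0 := by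
  rw [gramSchmidtNormed, real_inner_smul_left, gramSchmidt_inv_triangular ℝ v hkj, mul_zero]

/-- `v k` differs from its orthogonalization by a combination of earlier, orthogonal vectors, so the
unnormalized inner product is a squared norm. -/
theorem inner_gramSchmidtNormed_self_pos {v : ι → V} (hv : LinearIndependent ℝ v) (k : ι) :
    0 < inner ℝ (gramSchmidtNormed ℝ v k) (v k) := by
  have h0 := norm_pos_iff.2 (gramSchmidt_ne_zero k hv)
  have h : inner ℝ (gramSchmidt ℝ v k) (v k) = ‖gramSchmidt ℝ v k‖ ^ 2 := by
    conv_lhs => rw [gramSchmidt_def'' ℝ v k]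
    rw [inner_add_right, inner_sum, Finset.sum_eq_zero, add_zero, real_inner_self_eq_norm_sq]
    intro i hi
    rw [inner_smul_right, gramSchmidt_orthogonal ℝ v (Finset.mem_Iio.1 hi).ne', mul_zero]
  rw [gramSchmidtNormed, real_inner_smul_left, h]
  simp only [RCLike.ofReal_real_eq_id, id]
  positivity

variable [Fintype ι]

/-- By recursion: projecting onto a line divides by a squared norm, nonzero at an independent
family. -/
theorem contDiffAt_gramSchmidt {v : ι → V} (hv : LinearIndependent ℝ v) {m : WithTop ℕ∞} (k : ι) :
    ContDiffAt ℝ m (fun u : ι → V => gramSchmidt ℝ u k) v := by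
  induction k using WellFoundedLT.induction with
  | ind k ih =>
    have hk : ∀ j, ContDiffAt ℝ m (fun u : ι → V => u j) v := fun j =>
      (ContinuousLinearMap.proj (R := ℝ) (φ := fun _ : ι => V) j).contDiff.contDiffAt
    simp_rw [gramSchmidt_def ℝ _ k, Submodule.starProjection_singleton]
    refine (hk k).sub (ContDiffAt.sum fun i hi => ?_)
    have hi' := ih i (Finset.mem_Iio.1 hi)
    refine (((hi'.inner ℝ (hk k)).div (hi'.norm_sq ℝ) ?_)).smul hi'
    simpa using gramSchmidt_ne_zero i hv

theorem contDiffAt_gramSchmidtNormed {v : ι → V} (hv : LinearIndependent ℝ v) {m : WithTop ℕ∞}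
    (k : ι) : ContDiffAt ℝ m (fun u : ι → V => gramSchmidtNormed ℝ u k) v := by
  have h := contDiffAt_gramSchmidt hv (m := m) k
  have h0 := gramSchmidt_ne_zero k hv
  exact ((h.norm ℝ h0).inv (norm_ne_zero_iff.2 h0)).smul h

/-- An orthonormal basis in which a family is triangular with positive diagonal coefficients is
obtained from it by Gram-Schmidt orthogonalization. -/
theorem gramSchmidt_eq_of_triangular (b : OrthonormalBasis ι ℝ V) {v : ι → V}
    (h0 : ∀ k j, k < j → inner ℝ (b j) (v k) = 0) (hpos : ∀ k, 0 < inner ℝ (b k) (v k)) (k : ι) :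
    gramSchmidt ℝ v k = inner ℝ (b k) (v k) • b k := by
  induction k using WellFoundedLT.induction with
  | ind k ih =>
    have hterm : ∀ i ∈ Finset.Iio k, (Submodule.span ℝ {gramSchmidt ℝ v i}).starProjection (v k) =
        inner ℝ (b i) (v k) • b i := by
      intro i hi
      have hi0 := (hpos i).ne'
      rw [Submodule.starProjection_singleton, ih i (Finset.mem_Iio.1 hi), real_inner_smul_left,
        norm_smul, b.orthonormal.1, mul_one, smul_smul, Real.norm_of_nonneg (hpos i).le]
      congr 1
      simp only [RCLike.ofReal_real_eq_id, id]
      field_simp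
    rw [gramSchmidt_def, Finset.sum_congr rfl hterm, sub_eq_iff_eq_add]
    -- In the expansion of `v k`, terms beyond `k` vanish by triangularity and those before `k` are
    -- the subtracted projections.
    conv_lhs => rw [← b.sum_repr' (v k)]
    have hsub : insert k (Finset.Iio k) ⊆ Finset.univ := Finset.subset_univ _
    rw [← Finset.sum_subset hsub, Finset.sum_insert (by simp)]
    intro j _ hj
    have : k < j := by
      simp only [Finset.mem_insert, Finset.mem_Iio, not_or, not_lt] at hj
      exact lt_of_le_of_ne hj.2 (Ne.symm hj.1)
    rw [h0 k j this, zero_smul]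

theorem gramSchmidtNormed_eq_of_triangular (b : OrthonormalBasis ι ℝ V) {v : ι → V}
    (h0 : ∀ k j, k < j → inner ℝ (b j) (v k) = 0) (hpos : ∀ k, 0 < inner ℝ (b k) (v k)) (k : ι) :
    gramSchmidtNormed ℝ v k = b k := by
  rw [gramSchmidtNormed, gramSchmidt_eq_of_triangular b h0 hpos, smul_smul, norm_smul,
    b.orthonormal.1, mul_one, Real.norm_of_nonneg (hpos k).le]
  simp [(hpos k).ne']

/-- Gram-Schmidt preserves the span and here produces `b`, so `v` spans, with as many vectors as the
dimension. -/
theorem linearIndependent_of_triangular (b : OrthonormalBasis ι ℝ V) {v : ι → V}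
    (h0 : ∀ k j, k < j → inner ℝ (b j) (v k) = 0) (hpos : ∀ k, 0 < inner ℝ (b k) (v k)) :
    LinearIndependent ℝ v := by
  refine linearIndependent_of_top_le_span_of_card_eq_finrank ?_
    (Module.finrank_eq_card_basis b.toBasis).symm
  rw [← span_gramSchmidt ℝ v, ← span_gramSchmidtNormed_range,
    funext (gramSchmidtNormed_eq_of_triangular b h0 hpos), ← b.coe_toBasis, b.toBasis.span_eq]

end GramSchmidt

/-! ### Frames and invariant row coordinates. -/

namespace CorrelationManifold

open InnerProductSpace

variable {n d : ℕ}

/-- Right multiplication of row vectors by an orthogonal matrix, as a linear isometry. -/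
noncomputable def rightMulIsometry (Q : O d) :
    EuclideanSpace ℝ (Fin d) ≃ₗᵢ[ℝ] EuclideanSpace ℝ (Fin d) :=
  LinearIsometry.toLinearIsometryEquiv
    (LinearMap.isometryOfInner
      { toFun := fun v => WithLp.toLp 2 (Matrix.vecMul v.ofLp (Q : Matrix (Fin d) (Fin d) ℝ))
        map_add' := fun v w => by simp [Matrix.add_vecMul]
        map_smul' := fun a v => by simp [Matrix.smul_vecMul] }
      (fun v w => by
        have hQ : (Q : Matrix (Fin d) (Fin d) ℝ) * (Q : Matrix (Fin d) (Fin d) ℝ).transpose = 1 :=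
          Matrix.mem_orthogonalGroup_iff (Fin d) ℝ |>.1 Q.2
        simp only [EuclideanSpace.inner_eq_star_dotProduct, LinearMap.coe_mk, AddHom.coe_mk,
          star_trivial]
        rw [← Matrix.dotProduct_mulVec, ← Matrix.vecMul_transpose, Matrix.vecMul_vecMul, hQ,
          Matrix.vecMul_one])) rfl

theorem coe_rightMul (Y : T n d) (Q : O d) (i : Fin n) :
    (rightMul Y Q i : EuclideanSpace ℝ (Fin d)) =
      rightMulIsometry Q (Y i : EuclideanSpace ℝ (Fin d)) :=
  rfl

/-- Any orthonormal basis is carried to any other by right multiplication with an orthogonal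
matrix. -/
theorem exists_rightMulIsometry_eq_sum
    (b b' : OrthonormalBasis (Fin d) ℝ (EuclideanSpace ℝ (Fin d))) :
    ∃ Q : O d, ∀ v, rightMulIsometry Q v = ∑ j, inner ℝ (b j) v • b' j := by
  let s := EuclideanSpace.basisFun (Fin d) ℝ
  let A : O d := ⟨_, s.toMatrix_orthonormalBasis_mem_orthogonal b⟩
  let B : O d := ⟨_, s.toMatrix_orthonormalBasis_mem_orthogonal b'⟩
  -- The columns of `A` and `B` are the two bases: `A` reads off the coordinates in `b`, and `star
  -- B` recombines them in `b'`.
  refine ⟨A * star B, fun v => ?_⟩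
  ext l
  change Matrix.vecMul v.ofLp ((A : Matrix (Fin d) (Fin d) ℝ) *
    star (B : Matrix (Fin d) (Fin d) ℝ)) l = _
  rw [← Matrix.vecMul_vecMul]
  simp only [Matrix.vecMul, dotProduct, PiLp.inner_apply]
  simp [A, B, s, Module.Basis.toMatrix_apply, Matrix.star_apply, mul_comm]

/-- The rows of `Y` selected by `e`. -/
def selectedRows (e : Fin d → Fin n) (Y : T n d) : Fin d → EuclideanSpace ℝ (Fin d) :=
  fun k => Y (e k)

/-- The orthonormal basis obtained by orthogonalization of the rows of `Y` selected by `e`. -/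
noncomputable def frame (e : Fin d → Fin n) (Y : T n d) :
    OrthonormalBasis (Fin d) ℝ (EuclideanSpace ℝ (Fin d)) :=
  gramSchmidtOrthonormalBasis (by simp) (selectedRows e Y)

/-- The coordinates of the rows of `Y` in the orthonormal basis `frame e Y`. -/
noncomputable def rowCoord (e : Fin d → Fin n) (Y : T n d) (i : Fin n) (j : Fin d) : ℝ :=
  inner ℝ (frame e Y j) (Y i : EuclideanSpace ℝ (Fin d))

variable {e : Fin d → Fin n} {Y : T n d}

/-- The library basis substitutes other vectors only where Gram-Schmidt gives zero, which
independence excludes. -/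
theorem frame_apply (hY : LinearIndependent ℝ (selectedRows e Y)) (j : Fin d) :
    frame e Y j = gramSchmidtNormed ℝ (selectedRows e Y) j := by
  refine gramSchmidtOrthonormalBasis_apply _ fun h => ?_
  have := gramSchmidtNormed_unit_length j hY
  rw [h, norm_zero] at this
  exact zero_ne_one this

theorem sum_rowCoord_smul (e : Fin d → Fin n) (Y : T n d) (i : Fin n) :
    ∑ j, rowCoord e Y i j • frame e Y j = (Y i : EuclideanSpace ℝ (Fin d)) :=
  (frame e Y).sum_repr' _

theorem exists_rowCoord_ne_zero (e : Fin d → Fin n) (Y : T n d) (i : Fin n) :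
    ∃ j, rowCoord e Y i j ≠ 0 := by
  by_contra! h
  have h1 := sum_rowCoord_smul e Y i
  simp only [h, zero_smul, Finset.sum_const_zero] at h1
  exact ne_zero_of_mem_unit_sphere (Y i) h1.symm

theorem rowCoord_of_lt (hY : LinearIndependent ℝ (selectedRows e Y)) {k j : Fin d} (h : k < j) :
    rowCoord e Y (e k) j = 0 := by
  rw [rowCoord, frame_apply hY]
  exact inner_gramSchmidtNormed_of_lt (selectedRows e Y) h

theorem rowCoord_self_pos (hY : LinearIndependent ℝ (selectedRows e Y)) (k : Fin d) :
    0 < rowCoord e Y (e k) k := by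
  rw [rowCoord, frame_apply hY]
  exact inner_gramSchmidtNormed_self_pos hY k

theorem frame_eq_of_triangular (b : OrthonormalBasis (Fin d) ℝ (EuclideanSpace ℝ (Fin d)))
    (h0 : ∀ k j, k < j → inner ℝ (b j) (selectedRows e Y k) = 0)
    (hpos : ∀ k, 0 < inner ℝ (b k) (selectedRows e Y k)) (j : Fin d) : frame e Y j = b j := by
  rw [frame_apply (linearIndependent_of_triangular b h0 hpos)]
  exact gramSchmidtNormed_eq_of_triangular b h0 hpos j

theorem selectedRows_rightMul (e : Fin d → Fin n) (Y : T n d) (Q : O d) :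
    selectedRows e (rightMul Y Q) = fun k => rightMulIsometry Q (selectedRows e Y k) :=
  rfl

theorem linearIndependent_selectedRows_rightMul (hY : LinearIndependent ℝ (selectedRows e Y))
    (Q : O d) : LinearIndependent ℝ (selectedRows e (rightMul Y Q)) :=
  hY.map' (rightMulIsometry Q).toLinearEquiv.toLinearMap (rightMulIsometry Q).toLinearEquiv.ker

/-- The rotated frame is triangular with positive diagonal for the rotated rows, hence is their
frame; isometries preserve inner products. -/
theorem rowCoord_rightMul (hY : LinearIndependent ℝ (selectedRows e Y)) (Q : O d) (i : Fin n)
    (j : Fin d) : rowCoord e (rightMul Y Q) i j = rowCoord e Y i j := by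
  have hframe : frame e (rightMul Y Q) j = (frame e Y).map (rightMulIsometry Q) j := by
    apply frame_eq_of_triangular
    · intro k j hkj
      rw [selectedRows_rightMul, OrthonormalBasis.map_apply, LinearIsometryEquiv.inner_map_map]
      exact rowCoord_of_lt hY hkj
    · intro k
      rw [selectedRows_rightMul, OrthonormalBasis.map_apply, LinearIsometryEquiv.inner_map_map]
      exact rowCoord_self_pos hY k
  rw [rowCoord, hframe, coe_rightMul, OrthonormalBasis.map_apply,
    LinearIsometryEquiv.inner_map_map, rowCoord]

theorem isOpen_linearIndependent_selectedRows (e : Fin d → Fin n) :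
    IsOpen {Y : T n d | LinearIndependent ℝ (selectedRows e Y)} := by
  refine isOpen_setOfPred_linearIndependent.preimage (f := selectedRows e) ?_
  unfold selectedRows
  fun_prop

section Smooth

variable [NeZero d]

instance isManifoldT (n d : ℕ) [NeZero d] : IsManifold (TModelWithCorners n d) ∞ (T n d) :=
  IsManifold.pi _

theorem contMDiff_coe_T :
    ContMDiff (TModelWithCorners n d) 𝓘(ℝ, Fin n → EuclideanSpace ℝ (Fin d)) ∞
      (fun (Y : T n d) i => (Y i : EuclideanSpace ℝ (Fin d))) :=
  contMDiff_pi_space.2 fun i =>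
    contMDiff_coe_sphere.comp (contMDiff_pi_apply (fun _ : Fin n => 𝓡 (d - 1)) i)

theorem contMDiffAt_rowCoord (hY : LinearIndependent ℝ (selectedRows e Y)) (i : Fin n)
    (j : Fin d) :
    ContMDiffAt (TModelWithCorners n d) 𝓘(ℝ, ℝ) ∞ (fun Z : T n d => rowCoord e Z i j) Y := by
  have hproj : ∀ k u, ContDiffAt ℝ ∞ (fun u : Fin n → EuclideanSpace ℝ (Fin d) => u k) u :=
    fun k u => (ContinuousLinearMap.proj (R := ℝ)
      (φ := fun _ : Fin n => EuclideanSpace ℝ (Fin d)) k).contDiff.contDiffAt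
  have hG : ContDiffAt ℝ ∞ (fun u : Fin n → EuclideanSpace ℝ (Fin d) =>
      inner ℝ (gramSchmidtNormed ℝ (fun k => u (e k)) j) (u i))
      (fun i => (Y i : EuclideanSpace ℝ (Fin d))) := by
    refine ContDiffAt.inner ℝ ?_ (hproj i _)
    exact ContDiffAt.comp (g := fun v : Fin d → EuclideanSpace ℝ (Fin d) => gramSchmidtNormed ℝ v j)
      (f := fun (u : Fin n → EuclideanSpace ℝ (Fin d)) k => u (e k)) _
      (contDiffAt_gramSchmidtNormed hY j) (contDiffAt_pi.2 fun k => hproj (e k) _)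
  -- Independence is open, so near `Y` the frame is given by the Gram-Schmidt formula on the ambient
  -- space.
  refine (hG.contMDiffAt.comp Y (contMDiff_coe_T Y)).congr_of_eventuallyEq ?_
  filter_upwards [(isOpen_linearIndependent_selectedRows e).mem_nhds hY] with Z hZ
  rw [rowCoord, frame_apply hZ]
  rfl

end Smooth

end CorrelationManifold

/-! ### The slices: free coordinates, normalized pivots and their inverse. -/

namespace CorrelationManifold

variable {n d : ℕ}

open Classical in
/-- The columns of the free coordinates of the `i`-th row in the slice given by the selected rows
`e` and the pivot columns `c`: those before the pivot in a selected row, all but the pivot in any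
other row. -/
def freeColumns (e : Fin d → Fin n) (c : Fin n → Fin d) (i : Fin n) : Finset (Fin d) :=
  if i ∈ range e then Finset.Iio (c i) else Finset.univ.erase (c i)

/-- The positions of the free coordinates. -/
abbrev FreeIndex (e : Fin d → Fin n) (c : Fin n → Fin d) : Type :=
  Σ i, {j // j ∈ freeColumns e c i}

variable {e : Fin d → Fin n} {c : Fin n → Fin d}

theorem freeColumns_selected (hc : ∀ k, c (e k) = k) (k : Fin d) :
    freeColumns e c (e k) = Finset.Iio k := by
  rw [freeColumns, if_pos (mem_range_self k), hc]

theorem pivot_notMem_freeColumns (i : Fin n) : c i ∉ freeColumns e c i := by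
  unfold freeColumns
  split_ifs <;> simp

theorem card_freeIndex (hc : ∀ k, c (e k) = k) :
    Fintype.card (FreeIndex e c) = n * (d - 1) - d * (d - 1) / 2 := by
  classical
  have he : Function.Injective e := fun k l h => by rw [← hc k, h, hc]
  -- Selected row `k` loses the `d - 1 - k` columns after its pivot. The additive form keeps
  -- natural-number subtraction exact.
  have hcard : ∀ i, (freeColumns e c i).card + (if i ∈ range e then d - 1 - (c i : ℕ) else 0) =
      d - 1 := by
    intro i
    have := (c i).2
    unfold freeColumns
    split_ifs
    · rw [Fin.card_Iio]; omega
    · rw [Finset.card_erase_of_mem (Finset.mem_univ _)]; simp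
  have hsel : ∑ i, (if i ∈ range e then d - 1 - (c i : ℕ) else 0) = d * (d - 1) / 2 := by
    rw [← Finset.sum_filter, show Finset.univ.filter (· ∈ range e) = Finset.univ.image e by
      ext; simp, Finset.sum_image he.injOn]
    simp only [hc]
    rw [← Finset.sum_range_id, ← Finset.sum_range_reflect, Finset.sum_range]
  have hsum : ∑ i, (freeColumns e c i).card + d * (d - 1) / 2 = n * (d - 1) := by
    rw [← hsel, ← Finset.sum_add_distrib, Finset.sum_congr rfl fun i _ => hcard i]
    simp
  rw [Fintype.card_sigma]
  simp only [Fintype.card_coe]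
  omega

variable {N : ℕ} (φ : FreeIndex e c ≃ Fin N) (σ : Fin n → ℝ)

/-- The matrix with prescribed free coordinates `w` and pivots `σ`, and zeros elsewhere. -/
def pivotMatrix (w : EuclideanSpace ℝ (Fin N)) (i : Fin n) (j : Fin d) : ℝ :=
  if h : j ∈ freeColumns e c i then w (φ ⟨i, j, h⟩) else if j = c i then σ i else 0

theorem pivotMatrix_pivot (w : EuclideanSpace ℝ (Fin N)) (i : Fin n) :
    pivotMatrix φ σ w i (c i) = σ i := by
  rw [pivotMatrix, dif_neg (pivot_notMem_freeColumns i), if_pos rfl]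

theorem pivotMatrix_free (w : EuclideanSpace ℝ (Fin N)) (a : FreeIndex e c) :
    pivotMatrix φ σ w a.1 a.2 = w (φ a) := by
  rw [pivotMatrix, dif_pos a.2.2]

theorem pivotMatrix_selected_of_lt (hc : ∀ k, c (e k) = k) (w : EuclideanSpace ℝ (Fin N))
    {k j : Fin d} (h : k < j) : pivotMatrix φ σ w (e k) j = 0 := by
  rw [pivotMatrix, dif_neg, if_neg]
  · rw [hc]; exact h.ne'
  · rw [freeColumns_selected hc, Finset.mem_Iio]; exact h.le.not_gt

variable (b : OrthonormalBasis (Fin d) ℝ (EuclideanSpace ℝ (Fin d)))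

/-- The vector whose coordinates in the basis `b` are the `i`-th row of `pivotMatrix`. -/
noncomputable def pivotVector (w : EuclideanSpace ℝ (Fin N)) (i : Fin n) :
    EuclideanSpace ℝ (Fin d) :=
  ∑ j, pivotMatrix φ σ w i j • b j

theorem inner_pivotVector (w : EuclideanSpace ℝ (Fin N)) (i : Fin n) (j : Fin d) :
    inner ℝ (b j) (pivotVector φ σ b w i) = pivotMatrix φ σ w i j :=
  b.orthonormal.inner_right_fintype _ j

variable {σ} (hσ : ∀ i, σ i ≠ 0)

theorem pivotVector_ne_zero (hσ : ∀ i, σ i ≠ 0) (w : EuclideanSpace ℝ (Fin N)) (i : Fin n) :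
    pivotVector φ σ b w i ≠ 0 := by
  intro h
  have := inner_pivotVector φ σ b w i (c i)
  rw [h, inner_zero_right, pivotMatrix_pivot] at this
  exact hσ i this.symm

/-- The point of the slice with free coordinates `w`: its rows are the normalized pivot vectors. -/
noncomputable def slicePoint (hσ : ∀ i, σ i ≠ 0) (w : EuclideanSpace ℝ (Fin N)) : T n d := fun i =>
  ⟨‖pivotVector φ σ b w i‖⁻¹ • pivotVector φ σ b w i, by
    rw [mem_sphere_zero_iff_norm, norm_smul, norm_inv, norm_norm,
      inv_mul_cancel₀ (norm_ne_zero_iff.2 (pivotVector_ne_zero φ b hσ w i))]⟩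

theorem coe_slicePoint (w : EuclideanSpace ℝ (Fin N)) (i : Fin n) :
    (slicePoint φ b hσ w i : EuclideanSpace ℝ (Fin d)) =
      ‖pivotVector φ σ b w i‖⁻¹ • pivotVector φ σ b w i :=
  rfl

theorem inner_slicePoint (w : EuclideanSpace ℝ (Fin N)) (i : Fin n) (j : Fin d) :
    inner ℝ (b j) (slicePoint φ b hσ w i : EuclideanSpace ℝ (Fin d)) =
      ‖pivotVector φ σ b w i‖⁻¹ * pivotMatrix φ σ w i j := by
  rw [coe_slicePoint, real_inner_smul_right, inner_pivotVector]

theorem norm_pivotVector_inv_pos (hσ : ∀ i, σ i ≠ 0) (w : EuclideanSpace ℝ (Fin N)) (i : Fin n) :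
    0 < ‖pivotVector φ σ b w i‖⁻¹ :=
  inv_pos.2 (norm_pos_iff.2 (pivotVector_ne_zero φ b hσ w i))

theorem linearIndependent_slicePoint (hc : ∀ k, c (e k) = k) (hpos : ∀ k, 0 < σ (e k))
    (w : EuclideanSpace ℝ (Fin N)) :
    LinearIndependent ℝ (selectedRows e (slicePoint φ b hσ w)) := by
  refine linearIndependent_of_triangular b (fun k j hkj => ?_) fun k => ?_
  · rw [selectedRows, inner_slicePoint, pivotMatrix_selected_of_lt φ σ hc w hkj, mul_zero]
  · have h := pivotMatrix_pivot φ σ w (e k)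
    rw [hc] at h
    rw [selectedRows, inner_slicePoint, h]
    exact mul_pos (norm_pivotVector_inv_pos φ b hσ w _) (hpos k)

theorem rowCoord_slicePoint (hc : ∀ k, c (e k) = k) (hpos : ∀ k, 0 < σ (e k))
    (w : EuclideanSpace ℝ (Fin N)) (i : Fin n) (j : Fin d) :
    rowCoord e (slicePoint φ b hσ w) i j =
      ‖pivotVector φ σ b w i‖⁻¹ * pivotMatrix φ σ w i j := by
  rw [rowCoord, frame_eq_of_triangular b, inner_slicePoint]
  · intro k j hkj
    rw [selectedRows, inner_slicePoint, pivotMatrix_selected_of_lt φ σ hc w hkj, mul_zero]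
  · intro k
    have h := pivotMatrix_pivot φ σ w (e k)
    rw [hc] at h
    rw [selectedRows, inner_slicePoint, h]
    exact mul_pos (norm_pivotVector_inv_pos φ b hσ w _) (hpos k)

/-- The open set of those `Y` whose selected rows are independent and whose pivot coordinates have
the same signs as `σ`. -/
def sliceDomain (e : Fin d → Fin n) (c : Fin n → Fin d) (σ : Fin n → ℝ) : Set (T n d) :=
  {Y | LinearIndependent ℝ (selectedRows e Y) ∧ ∀ i, 0 < σ i * rowCoord e Y i (c i)}

/-- The free coordinates of `Y`, after scaling every row to the prescribed pivot. -/
noncomputable def sliceCoord (σ : Fin n → ℝ) (Y : T n d) : EuclideanSpace ℝ (Fin N) :=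
  WithLp.toLp 2 fun a => σ (φ.symm a).1 *
    rowCoord e Y (φ.symm a).1 (φ.symm a).2 / rowCoord e Y (φ.symm a).1 (c (φ.symm a).1)

theorem sliceCoord_apply (σ : Fin n → ℝ) (Y : T n d) (a : FreeIndex e c) :
    sliceCoord φ σ Y (φ a) = σ a.1 * rowCoord e Y a.1 a.2 / rowCoord e Y a.1 (c a.1) := by
  change (fun x : FreeIndex e c => σ x.1 * rowCoord e Y x.1 x.2 / rowCoord e Y x.1 (c x.1))
    (φ.symm (φ a)) = _
  rw [φ.symm_apply_apply]

theorem slicePoint_mem_sliceDomain (hc : ∀ k, c (e k) = k) (hpos : ∀ k, 0 < σ (e k))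
    (w : EuclideanSpace ℝ (Fin N)) : slicePoint φ b hσ w ∈ sliceDomain e c σ := by
  refine ⟨linearIndependent_slicePoint φ b hσ hc hpos w, fun i => ?_⟩
  rw [rowCoord_slicePoint φ b hσ hc hpos, pivotMatrix_pivot, mul_left_comm]
  exact mul_pos (norm_pivotVector_inv_pos φ b hσ w i) (mul_self_pos.2 (hσ i))

/-- The normalizing factor of each row cancels in the ratio to the pivot. -/
theorem sliceCoord_slicePoint (hc : ∀ k, c (e k) = k) (hpos : ∀ k, 0 < σ (e k))
    (w : EuclideanSpace ℝ (Fin N)) : sliceCoord φ σ (slicePoint φ b hσ w) = w := by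
  ext a
  have h1 := (norm_pivotVector_inv_pos φ b hσ w (φ.symm a).1).ne'
  have h2 := hσ (φ.symm a).1
  simp only [sliceCoord]
  rw [rowCoord_slicePoint φ b hσ hc hpos, rowCoord_slicePoint φ b hσ hc hpos, pivotMatrix_pivot,
    pivotMatrix_free, φ.apply_symm_apply, mul_left_comm, mul_div_mul_left _ _ h1,
    mul_div_cancel_left₀ _ h2]

theorem pivotMatrix_sliceCoord (hc : ∀ k, c (e k) = k) {Y : T n d} (hY : Y ∈ sliceDomain e c σ)
    (i : Fin n) (j : Fin d) :
    pivotMatrix φ σ (sliceCoord φ σ Y) i j =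
      σ i / rowCoord e Y i (c i) * rowCoord e Y i j := by
  have hi : rowCoord e Y i (c i) ≠ 0 := fun h => by simpa [h] using hY.2 i
  by_cases h : j ∈ freeColumns e c i
  · rw [pivotMatrix, dif_pos h]
    rw [sliceCoord_apply]
    ring
  · rw [pivotMatrix, dif_neg h]
    split_ifs with hj
    · rw [hj, div_mul_cancel₀ _ hi]
    · have hsel : i ∈ range e := by
        by_contra hsel
        rw [freeColumns, if_neg hsel] at h
        exact h (Finset.mem_erase.2 ⟨hj, Finset.mem_univ _⟩)
      obtain ⟨k, rfl⟩ := hsel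
      rw [freeColumns_selected hc, Finset.mem_Iio, not_lt] at h
      rw [hc] at hj
      rw [rowCoord_of_lt hY.1 (lt_of_le_of_ne h (Ne.symm hj)), mul_zero]

/-- The pivot vector is a multiple of the row with the coordinates of `Y`; matching signs make the
factor positive, so normalization removes it. The result is `Y` carried from its own frame to `b`.
-/
theorem slicePoint_sliceCoord (hc : ∀ k, c (e k) = k) {Y : T n d} (hY : Y ∈ sliceDomain e c σ)
    (i : Fin n) :
    (slicePoint φ b hσ (sliceCoord φ σ Y) i : EuclideanSpace ℝ (Fin d)) =
      ∑ j, rowCoord e Y i j • b j := by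
  have hi : rowCoord e Y i (c i) ≠ 0 := fun h => by simpa [h] using hY.2 i
  have hr : 0 < σ i / rowCoord e Y i (c i) := by
    have h := div_pos (hY.2 i) (mul_self_pos.2 hi)
    rwa [mul_div_mul_right _ _ hi] at h
  have hvec : pivotVector φ σ b (sliceCoord φ σ Y) i =
      (σ i / rowCoord e Y i (c i)) • ∑ j, rowCoord e Y i j • b j := by
    rw [pivotVector, Finset.smul_sum]
    exact Finset.sum_congr rfl fun j _ => by rw [pivotMatrix_sliceCoord φ hc hY, smul_smul]
  have hnorm : ‖∑ j, rowCoord e Y i j • b j‖ = 1 := by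
    obtain ⟨Q, hQ⟩ := exists_rightMulIsometry_eq_sum (frame e Y) b
    have h := hQ (Y i)
    unfold rowCoord
    rw [← h, LinearIsometryEquiv.norm_map, norm_eq_of_mem_sphere]
  rw [coe_slicePoint, hvec, norm_smul, hnorm, mul_one, Real.norm_of_nonneg hr.le, smul_smul,
    inv_mul_cancel₀ hr.ne', one_smul]

section Smooth

variable [NeZero d]

theorem contMDiff_slicePoint :
    ContMDiff 𝓘(ℝ, EuclideanSpace ℝ (Fin N)) (TModelWithCorners n d) ∞ (slicePoint φ b hσ) := by
  rw [contMDiff_pi_iff]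
  intro i
  refine ContMDiff.codRestrict_sphere (ContDiff.contMDiff ?_) _
  have hvec : ContDiff ℝ ∞ fun w => pivotVector φ σ b w i := by
    unfold pivotVector
    refine ContDiff.sum fun j _ => ContDiff.fun_smul ?_ contDiff_const
    unfold pivotMatrix
    split_ifs
    · fun_prop
    · exact contDiff_const
    · exact contDiff_const
  have h0 := fun w => pivotVector_ne_zero φ b hσ w i
  exact ((hvec.norm ℝ h0).inv fun w => norm_ne_zero_iff.2 (h0 w)).smul hvec

theorem contMDiffOn_sliceCoord (c : Fin n → Fin d) (φ : FreeIndex e c ≃ Fin N) (σ : Fin n → ℝ) :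
    ContMDiffOn (TModelWithCorners n d) 𝓘(ℝ, EuclideanSpace ℝ (Fin N)) ∞ (sliceCoord φ σ)
      (sliceDomain e c σ) := by
  intro Y hY
  refine ContMDiffAt.contMDiffWithinAt ?_
  have h : ContMDiffAt (TModelWithCorners n d) 𝓘(ℝ, Fin N → ℝ) ∞
      (fun Y : T n d => (sliceCoord φ σ Y).ofLp) Y := by
    rw [contMDiffAt_pi_space]
    intro a
    have hi : rowCoord e Y (φ.symm a).1 (c (φ.symm a).1) ≠ 0 := fun h => by
      simpa [h] using hY.2 (φ.symm a).1
    exact (contMDiffAt_const.mul (contMDiffAt_rowCoord hY.1 _ _)).div₀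
      (contMDiffAt_rowCoord hY.1 _ _) hi
  exact ((EuclideanSpace.equiv (Fin N) ℝ).symm.contDiff.contMDiff _).comp Y h

theorem isOpen_sliceDomain (e : Fin d → Fin n) (c : Fin n → Fin d) (σ : Fin n → ℝ) :
    IsOpen (sliceDomain e c σ) := by
  have hcont : ContinuousOn (fun (Y : T n d) i => σ i * rowCoord e Y i (c i))
      {Y | LinearIndependent ℝ (selectedRows e Y)} :=
    continuousOn_pi.2 fun i Y hY =>
      ((contMDiffAt_rowCoord hY i (c i)).continuousAt.const_mul (σ i)).continuousWithinAt
  have hopen : IsOpen {u : Fin n → ℝ | ∀ i, 0 < u i} := by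
    simp only [ofPred_forall]
    exact isOpen_iInter_of_finite fun i => isOpen_lt continuous_const (continuous_apply i)
  exact hcont.isOpen_inter_preimage (isOpen_linearIndependent_selectedRows e) hopen

end Smooth

end CorrelationManifold

/-! ### Rank, freeness, properness and slices through every point. -/

namespace CorrelationManifold

variable {n d : ℕ}

theorem row_submatrix_toMatrix (e : Fin d → Fin n) (Y : T n d) :
    ((toMatrix Y).submatrix e id).row =
      fun k => (EuclideanSpace.equiv (Fin d) ℝ) (selectedRows e Y k) :=
  rfl

theorem linearIndependent_selectedRows_iff (e : Fin d → Fin n) (Y : T n d) :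
    LinearIndependent ℝ (selectedRows e Y) ↔
      LinearIndependent ℝ ((toMatrix Y).submatrix e id).row := by
  rw [row_submatrix_toMatrix]
  exact (LinearMap.linearIndependent_iff_of_injOn
    (EuclideanSpace.equiv (Fin d) ℝ).toLinearEquiv.toLinearMap
    (EuclideanSpace.equiv (Fin d) ℝ).injective.injOn).symm

/-- A matrix has rank `d` if and only if some `d` of its rows are linearly independent. -/
theorem mem_TStar_iff (Y : T n d) :
    Y ∈ TStar n d ↔ ∃ e : Fin d → Fin n, LinearIndependent ℝ (selectedRows e Y) := by
  constructor
  · intro hY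
    obtain ⟨f, hf, -, hli⟩ :=
      Submodule.exists_fun_fin_finrank_span_eq ℝ (range (toMatrix Y).row)
    choose g hg using hf
    have hr : Module.finrank ℝ (Submodule.span ℝ (range (toMatrix Y).row)) = d := by
      rw [← Matrix.rank_eq_finrank_span_row]; exact hY
    refine ⟨fun k => g (Fin.cast hr.symm k), ?_⟩
    rw [linearIndependent_selectedRows_iff]
    have hrow : ((toMatrix Y).submatrix (fun k => g (Fin.cast hr.symm k)) id).row =
        f ∘ Fin.cast hr.symm := funext fun k => hg (Fin.cast hr.symm k)
    rw [hrow]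
    exact hli.comp _ (Fin.cast_injective _)
  · rintro ⟨e, he⟩
    rw [linearIndependent_selectedRows_iff] at he
    have h1 := he.rank_matrix
    rw [Fintype.card_fin] at h1
    refine le_antisymm ((toMatrix Y).rank_le_width) ?_
    exact h1.symm.le.trans (Matrix.rank_submatrix_le _ _ _)

theorem isOpen_TStar (n d : ℕ) : IsOpen (TStar n d) := by
  have : TStar n d = ⋃ e : Fin d → Fin n, {Y | LinearIndependent ℝ (selectedRows e Y)} := by
    ext Y
    simp [mem_TStar_iff]
  rw [this]
  exact isOpen_iUnion isOpen_linearIndependent_selectedRows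

theorem coe_smul_TStar (Q : (O d)ᵐᵒᵖ) (Y : TStar n d) :
    ((Q • Y : TStar n d) : T n d) = rightMul Y Q.unop :=
  rfl

theorem smul_eq_self_imp (Y : TStar n d) (Q : (O d)ᵐᵒᵖ) (h : Q • Y = Y) : Q = 1 := by
  obtain ⟨e, he⟩ := (mem_TStar_iff Y.1).1 Y.2
  rw [linearIndependent_selectedRows_iff, Matrix.linearIndependent_rows_iff_isUnit] at he
  have h1 : toMatrix Y.1 * (Q.unop : Matrix (Fin d) (Fin d) ℝ) = toMatrix Y.1 := by
    rw [← toMatrix_rightMul, ← coe_smul_TStar, h]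
  have h2 : (toMatrix Y.1).submatrix e id * (Q.unop : Matrix (Fin d) (Fin d) ℝ) =
      (toMatrix Y.1).submatrix e id * 1 := by
    rw [mul_one]
    exact congrArg (fun A => A.submatrix e id) h1
  exact MulOpposite.unop_injective (Subtype.ext (he.mul_left_cancel h2))

instance compactSpace_orthogonalGroup (d : ℕ) : CompactSpace (O d) := by
  refine (isCompact_iff_compactSpace
    (s := (Matrix.orthogonalGroup (Fin d) ℝ : Set (Matrix (Fin d) (Fin d) ℝ)))).1 ?_
  have hK : IsCompact (univ.pi fun _ : Fin d => univ.pi fun _ : Fin d => Icc (-1 : ℝ) 1) :=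
    isCompact_univ_pi fun _ => isCompact_univ_pi fun _ => isCompact_Icc
  refine hK.of_isClosed_subset (isClosed_unitary (R := Matrix (Fin d) (Fin d) ℝ)) ?_
  intro Q hQ i _ j _
  exact abs_le.1 (entry_norm_bound_of_unitary (𝕜 := ℝ) hQ i j)

instance continuousSMul_TStar (n d : ℕ) : ContinuousSMul (O d)ᵐᵒᵖ (TStar n d) where
  continuous_smul := by
    refine Continuous.subtype_mk (continuous_pi fun i => Continuous.subtype_mk ?_ _) _
    refine (PiLp.continuous_toLp 2 _).comp (Continuous.matrix_vecMul ?_ ?_)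
    · exact (PiLp.continuous_ofLp 2 _).comp (continuous_subtype_val.comp
        ((continuous_apply i).comp (continuous_subtype_val.comp continuous_snd)))
    · exact continuous_subtype_val.comp (MulOpposite.continuous_unop.comp continuous_fst)

/-- A continuous action of a compact group on a Hausdorff space is proper. -/
theorem properSMul_of_compactSpace {G X : Type*} [Group G] [TopologicalSpace G] [CompactSpace G]
    [TopologicalSpace X] [T2Space X] [MulAction G X] [ContinuousSMul G X] : ProperSMul G X := by
  rw [properSMul_iff_continuousSMul_ultrafilter_tendsto_t2]
  refine ⟨inferInstance, fun 𝒰 _ _ _ => ?_⟩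
  -- Properness only asks that the group component of the ultrafilter converge, which compactness
  -- provides.
  obtain ⟨g, -, hg⟩ := isCompact_univ.ultrafilter_le_nhds (𝒰.map Prod.fst) (by simp)
  exact ⟨g, hg⟩

theorem proj_eq_iff (Y Z : TStar n d) :
    proj n d Y = proj n d Z ↔ ∃ Q : O d, rightMul Z.1 Q = Y.1 := by
  rw [proj, Quotient.eq, MulAction.orbitRel_apply, MulAction.mem_orbit_iff]
  exact ⟨fun ⟨g, hg⟩ => ⟨g.unop, congrArg Subtype.val hg⟩,
    fun ⟨Q, hQ⟩ => ⟨MulOpposite.op Q, Subtype.ext hQ⟩⟩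

theorem isOpenQuotientMap_proj (n d : ℕ) : IsOpenQuotientMap (proj n d) :=
  MulAction.isOpenQuotientMap_quotientMk

/-- The projection `T*_{n,d} → M*_{n,d}` has smooth slices through every point. -/
theorem exists_smoothSlice [NeZero d] (hopen : IsOpen (TStar n d)) (Y₀ : TStar n d) :
    letI := chartedSpaceTStar hopen
    ∃ S : SmoothSlice (TModelWithCorners n d)
        (EuclideanSpace ℝ (Fin (n * (d - 1) - d * (d - 1) / 2))) (proj n d),
      Y₀ ∈ S.source ∧ S.sect (S.coord Y₀) = Y₀ := by
  let := chartedSpaceTStar hopen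
  obtain ⟨e, he⟩ := (mem_TStar_iff Y₀.1).1 Y₀.2
  have hinj : Function.Injective e := fun k l hkl => he.injective (by simp [selectedRows, hkl])
  obtain ⟨c, hc, hne⟩ : ∃ c : Fin n → Fin d, (∀ k, c (e k) = k) ∧
      ∀ i, rowCoord e Y₀.1 i (c i) ≠ 0 := by
    choose g hg using exists_rowCoord_ne_zero e Y₀.1
    -- Pivots are diagonal in selected rows; elsewhere any nonzero coordinate of the unit row
    -- serves.
    refine ⟨Function.extend e id g, hinj.extend_apply id g, fun i => ?_⟩
    by_cases hi : ∃ k, e k = i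
    · obtain ⟨k, rfl⟩ := hi
      rw [hinj.extend_apply]
      exact (rowCoord_self_pos he k).ne'
    · rw [Function.extend_apply' _ _ _ hi]
      exact hg i
  -- With the pivots of `Y₀` itself, the sign condition at `Y₀` says that squares are positive; with
  -- its own frame as `b`, the section passes through `Y₀`.
  let σ : Fin n → ℝ := fun i => rowCoord e Y₀.1 i (c i)
  have hpos : ∀ k, 0 < σ (e k) := fun k => by
    simp only [σ, hc]
    exact rowCoord_self_pos he k
  let φ : FreeIndex e c ≃ Fin (n * (d - 1) - d * (d - 1) / 2) :=
    Fintype.equivFinOfCardEq (card_freeIndex hc)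
  let b := frame e Y₀.1
  have hval : ContMDiff (TModelWithCorners n d) (TModelWithCorners n d) ∞
      (Subtype.val : TStar n d → T n d) :=
    contMDiff_subtype_val (U := ⟨TStar n d, hopen⟩)
  have hY₀ : Y₀.1 ∈ sliceDomain e c σ := ⟨he, fun i => mul_self_pos.2 (hne i)⟩
  refine ⟨{ source := Subtype.val ⁻¹' sliceDomain e c σ
            coord := fun Y => sliceCoord φ σ Y.1
            sect := fun w => ⟨slicePoint φ b hne w,
              (mem_TStar_iff _).2 ⟨e, linearIndependent_slicePoint φ b hne hc hpos w⟩⟩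
            isOpen_source := (isOpen_sliceDomain e c σ).preimage continuous_subtype_val
            contMDiffOn_coord :=
              (contMDiffOn_sliceCoord c φ σ).comp hval.contMDiffOn fun _ h => h
            contMDiff_sect := ContMDiff.of_coe_opens (U := ⟨TStar n d, hopen⟩)
              (contMDiff_slicePoint φ b hne)
            sect_mem := slicePoint_mem_sliceDomain φ b hne hc hpos
            coord_sect := sliceCoord_slicePoint φ b hne hc hpos
            proj_sect_coord := ?_
            saturated := ?_ }, hY₀, ?_⟩
  · intro Y hY
    obtain ⟨Q, hQ⟩ := exists_rightMulIsometry_eq_sum (frame e Y.1) b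
    refine (proj_eq_iff _ _).2 ⟨Q, funext fun i => Subtype.ext ?_⟩
    rw [slicePoint_sliceCoord φ b hne hc hY, coe_rightMul, hQ]
    rfl
  · intro Y hY Z hZ
    obtain ⟨Q, hQ⟩ := (proj_eq_iff _ _).1 hZ
    rw [mem_preimage, ← hQ]
    refine ⟨⟨linearIndependent_selectedRows_rightMul hY.1 Q, fun i => ?_⟩, ?_⟩
    · rw [rowCoord_rightMul hY.1]
      exact hY.2 i
    · unfold sliceCoord
      simp only [rowCoord_rightMul hY.1]
  · refine Subtype.ext (funext fun i => Subtype.ext ?_)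
    exact (slicePoint_sliceCoord φ b hne hc hY₀ i).trans (sum_rowCoord_smul e Y₀.1 i)

end CorrelationManifold

theorem mainTheorem6 (n d : ℕ) [NeZero d] (hdn : d ≤ n) :
    -- `T_{n,d}` is a smooth manifold
    IsManifold (CorrelationManifold.TModelWithCorners n d) ∞ (CorrelationManifold.T n d) ∧
    -- `T*_{n,d}` is open in it
    ∃ hopen : IsOpen (CorrelationManifold.TStar n d),
      letI := CorrelationManifold.chartedSpaceTStar hopen
      -- hence, with the restricted charts, a smooth manifold, smoothly embedded in `T_{n,d}`
      IsManifold (CorrelationManifold.TModelWithCorners n d) ∞ (CorrelationManifold.TStar n d) ∧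
      Manifold.IsSmoothEmbedding (CorrelationManifold.TModelWithCorners n d)
        (CorrelationManifold.TModelWithCorners n d) ∞
        (Subtype.val : CorrelationManifold.TStar n d → CorrelationManifold.T n d) ∧
      -- the right action of `O_d` on `T*_{n,d}` is free
      (∀ (Y : CorrelationManifold.TStar n d) (Q : (CorrelationManifold.O d)ᵐᵒᵖ),
        Q • Y = Y → Q = 1) ∧
      -- and proper
      ProperSMul (CorrelationManifold.O d)ᵐᵒᵖ (CorrelationManifold.TStar n d) ∧
      -- the orbit space, with the quotient topology, is Hausdorff and second countable
      T2Space (CorrelationManifold.MStar n d) ∧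
      SecondCountableTopology (CorrelationManifold.MStar n d) ∧
      -- and has the structure of a smooth manifold of dimension `n(d-1) - d(d-1)/2`,
      -- for which the projection is a smooth submersion
      ∃ _ : ChartedSpace (EuclideanSpace ℝ (Fin (n * (d - 1) - d * (d - 1) / 2)))
          (CorrelationManifold.MStar n d),
        IsManifold (𝓡 (n * (d - 1) - d * (d - 1) / 2)) ∞ (CorrelationManifold.MStar n d) ∧
        ContMDiff (CorrelationManifold.TModelWithCorners n d)
          (𝓡 (n * (d - 1) - d * (d - 1) / 2)) ∞ (CorrelationManifold.proj n d) ∧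
        ∀ Y : CorrelationManifold.TStar n d,
          Function.Surjective (mfderiv (CorrelationManifold.TModelWithCorners n d)
            (𝓡 (n * (d - 1) - d * (d - 1) / 2)) (CorrelationManifold.proj n d) Y) := by
  have hopen := CorrelationManifold.isOpen_TStar n d
  have hproper : ProperSMul (CorrelationManifold.O d)ᵐᵒᵖ (CorrelationManifold.TStar n d) :=
    CorrelationManifold.properSMul_of_compactSpace
  refine ⟨inferInstance, hopen, ?_⟩
  let := CorrelationManifold.chartedSpaceTStar hopen
  choose S hS hsect using CorrelationManifold.exists_smoothSlice hopen
  refine ⟨?_, ?_, CorrelationManifold.smul_eq_self_imp, hproper,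
    t2Space_quotient_mulAction_of_properSMul, ContinuousConstSMul.secondCountableTopology,
    SmoothSlice.exists_isManifold S hS hsect (CorrelationManifold.isOpenQuotientMap_proj n d)⟩
  · exact inferInstanceAs (IsManifold (CorrelationManifold.TModelWithCorners n d) ∞
      (⟨CorrelationManifold.TStar n d, hopen⟩ :
        TopologicalSpace.Opens (CorrelationManifold.T n d)))
  · exact Manifold.IsSmoothEmbedding.of_opens ⟨CorrelationManifold.TStar n d, hopen⟩
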